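/- Let $X$ be a non-negative stochastic process on $\mathbb{R}^d$ with continuous sample paths and law $\mathbb{P}_X$ on $C(\mathbb{R}^d)$. Assume that there are $C,R>0$ with $X\le C\,\mathbf 1_{B_R(o)}$ almost surely, and that there is $r>0$ with $\mathbb{P}_X(X>0 \text{ on } B_r(o))>0$, where $B_R(o)$ is the closed ball of radius $R$ about the origin. Let $\mu_Y>0$, let $\Psi$ be an almost surely strictly positive random field on $\mathbb{R}^d$ with continuous sample paths, and let $N=\sum_{i\ge 1}\delta_{(s_i,u_i,X_i)}$ be a Cox process on $\mathbb{R}^d\times(0,\infty]\times C(\mathbb{R}^d)$ which, conditionally on $\Psi$, is a Poisson process directed by $\mu_Y^{-1}\Psi(s)\,ds\;u^{-2}du\;d\mathbb{P}_X$. Let $Y(t)=\sup_i u_iX_i(t-s_i)$ be the associated Cox extremal process, and let $Y^*$ be a random field with continuous sample paths which, conditionally on $\Psi$, is a copy of $Y$ that is independent of $N$. Let $K\subset\mathbb{R}^d$ be compact and $K_R=K\oplus B_R(o)$. For $y>0$ on $K$ put $$b_K^y(s)=\mu_Y^{-1}\,\mathbb{E}_X\Big[\sup_{t\in K}\frac{X(t-s)}{y(t)}\Big],\qquad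 \psi_K^y(s)=b_K^y(s)\,\Psi(s),\qquad N_K^y=\sum_{i}\delta_{s_i}\mathbf 1\Big\{\sup_{t\in K}\frac{X_i(t-s_i)}{y(t)}\ge u_i^{-1}\Big\}.$$ For a Borel set $D\subset K_R$ and a bandwidth $h>0$ let $$\widehat\psi_D^y(s)=h^{-d}\sum_{t\in N_K^y\cap D}c_D(t)^{-1}k\Big(\frac{s-t}{h}\Big),\qquad c_D(t)=h^{-d}\int_D k\Big(\frac{s-t}{h}\Big)ds,$$ where $k(s)=\frac{d+2}{2c_d}(1-\|s\|^2)\mathbf 1_{B_1(o)}(s)$, $c_d=|B_1(o)|$, is the Epanechnikov kernel. Then $\int_D\widehat\psi_D^y(s)\,ds$ is unbiased for $\int_D\psi_K^y(s)\,ds$, for every bandwidth $h>0$ and every Borel set $D\subset K_R$. Precisely, with all expectations taken in $[0,\infty]$: 1. For every fixed $y$ that is continuous and strictly positive on $K$, almost surely $\int_D\psi_K^y(s)\,ds<\infty$ and $$\mathbb{E}\Big[\int_D\widehat\psi_D^{y}(s)\,ds\,\Big|\,\Psi\Big]=\int_D\psi_K^{y}(s)\,ds,\qquad\text{and}\qquad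 \mathbb{E}\int_D\widehat\psi_D^{y}(s)\,ds=\mathbb{E}\int_D\psi_K^{y}(s)\,ds .$$ 2. For the random threshold $y=Y^*$, almost surely $\int_D\psi_K^{Y^*}(s)\,ds<\infty$, $$\mathbb{E}\Big[\int_D\widehat\psi_D^{Y^*}(s)\,ds\,\Big|\,\Psi,Y^*\Big]=\int_D\psi_K^{Y^*}(s)\,ds ,\qquad \mathbb{E}\Big[\int_D\widehat\psi_D^{Y^*}(s)\,ds\,\Big|\,Y^*\Big]=\mathbb{E}\Big[\int_D\psi_K^{Y^*}(s)\,ds\,\Big|\,Y^*\Big],$$ and $\mathbb{E}\int_D\widehat\psi_D^{Y^*}(s)\,ds=\mathbb{E}\int_D\psi_K^{Y^*}(s)\,ds$. -/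

import Mathlib

open MeasureTheory ProbabilityTheory Set
open scoped ENNReal NNReal Pointwise

namespace CoxExtremal

/-- The space `ℝ^d` with its Euclidean norm. -/
abbrev Space (d : ℕ) : Type := EuclideanSpace ℝ (Fin d)

/-- The space `C(ℝ^d)` of continuous sample paths, with the topology of uniform convergence on
compact sets. -/
abbrev PathSpace (d : ℕ) : Type := C(Space d, ℝ)

/-- `C(ℝ^d)` carries its Borel `σ`-algebra. -/
instance (d : ℕ) : MeasurableSpace (PathSpace d) := borel _

instance (d : ℕ) : BorelSpace (PathSpace d) := ⟨rfl⟩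

/-- The space of marked points `(s, u, X)`: storm centre, severity, shape. The severities live in
`(0, ∞]`, seen inside `[0, ∞]`; the point `0` has measure zero below. -/
abbrev Storm (d : ℕ) : Type := Space d × ℝ≥0∞ × PathSpace d

/-- The measure `u⁻² du` on `(0, ∞]` (it gives no mass to `0` and to `∞`). -/
noncomputable def severityMeasure : Measure ℝ≥0∞ :=
  ((volume.restrict (Ioi (0 : ℝ))).withDensity
    (fun u => ENNReal.ofReal ((u ^ 2)⁻¹))).map ENNReal.ofReal

/-- The directing measure `μY⁻¹ ψ(s) ds u⁻² du dPX` of the marked points, for a realization `ψ` of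
the spatial intensity process. -/
noncomputable def directingMeasure {d : ℕ} (μY : ℝ) (PX : Measure (PathSpace d))
    (ψ : PathSpace d) : Measure (Storm d) :=
  (ENNReal.ofReal μY)⁻¹ •
    ((volume.withDensity (fun s => ENNReal.ofReal (ψ s))).prod (severityMeasure.prod PX))

/-- The point process `∑ i, δ_{p i}` as a random measure. -/
noncomputable def pointProcess {Ω S : Type*} [MeasurableSpace S] (p : ℕ → Ω → S) (ω : Ω) :
    Measure S :=
  Measure.sum (fun i => Measure.dirac (p i ω))

/-- Conditionally on the `σ`-algebra `m`, the random measure `N` is a Poisson process with directing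
measure `Λ`: the numbers of points in finitely many disjoint sets of finite `Λ`-measure are
conditionally independent and Poisson distributed, with the `Λ`-measures as parameters. -/
def IsCoxProcess {Ω S : Type*} (m : MeasurableSpace Ω) [mΩ : MeasurableSpace Ω] [MeasurableSpace S]
    (N : Ω → Measure S) (Λ : Ω → Measure S) (P : Measure Ω) : Prop :=
  ∀ (n : ℕ) (B : Fin n → Set S) (k : Fin n → ℕ),
    (∀ j, MeasurableSet (B j)) → Pairwise (fun i j => Disjoint (B i) (B j)) →
    ∀ᵐ ω ∂P, (∀ j, Λ ω (B j) < ∞) →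
      (P⟦{ω' | ∀ j, N ω' (B j) = (k j : ℝ≥0∞)} | m⟧) ω
        = ∏ j, (poissonMeasure (Λ ω (B j)).toNNReal).real {k j}

/-- The `σ`-algebras `m₁`, `m₂` are conditionally independent given `m`. This is Mathlib's
`ProbabilityTheory.CondIndep`, by its characterization through conditional probabilities, which
makes sense without the assumption that `Ω` is a standard Borel space. -/
def CondIndependent {Ω : Type*} (m m₁ m₂ : MeasurableSpace Ω) [mΩ : MeasurableSpace Ω]
    (P : Measure Ω) : Prop :=
  ∀ A B : Set Ω, MeasurableSet[m₁] A → MeasurableSet[m₂] B →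
    P⟦A ∩ B | m⟧ =ᵐ[P] P⟦A | m⟧ * P⟦B | m⟧

/-- The Cox extremal process `Y(t) = sup_i u_i X_i(t - s_i)`, with values in `[0, ∞]`. -/
noncomputable def extremalProcess {Ω : Type*} {d : ℕ} (p : ℕ → Ω → Storm d) (ω : Ω) (t : Space d) :
    ℝ≥0∞ :=
  ⨆ i, (p i ω).2.1 * ENNReal.ofReal ((p i ω).2.2 (t - (p i ω).1))

/-- The quantity `sup_{t ∈ K} X(t - s) / y(t)`. -/
noncomputable def supRatio {d : ℕ} (K : Set (Space d)) (y : Space d → ℝ) (s : Space d)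
    (x : PathSpace d) : ℝ≥0∞ :=
  ⨆ t ∈ K, ENNReal.ofReal (x (t - s)) / ENNReal.ofReal (y t)

open Classical in
/-- The point process of storm centres contributing on `K` relative to the threshold `y`:
`∑ i, δ_{s_i} 1{sup_{t ∈ K} X_i(t - s_i) / y(t) ≥ 1 / u_i}`. -/
noncomputable def contributing {Ω : Type*} {d : ℕ} (p : ℕ → Ω → Storm d) (K : Set (Space d))
    (y : Space d → ℝ) (ω : Ω) : Measure (Space d) :=
  Measure.sum (fun i =>
    if (p i ω).2.1⁻¹ ≤ supRatio K y (p i ω).1 (p i ω).2.2 then Measure.dirac (p i ω).1 else 0)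

/-- The correcting factor `b_K^y(s) = μY⁻¹ E_X[sup_{t ∈ K} X(t - s) / y(t)]`. -/
noncomputable def correctingFactor {d : ℕ} (μY : ℝ) (PX : Measure (PathSpace d))
    (K : Set (Space d)) (y : Space d → ℝ) (s : Space d) : ℝ≥0∞ :=
  (ENNReal.ofReal μY)⁻¹ * ∫⁻ x, supRatio K y s x ∂PX

/-- The intensity function `ψ_K^y = b_K^y ψ`. -/
noncomputable def contributingIntensity {d : ℕ} (μY : ℝ) (PX : Measure (PathSpace d))
    (K : Set (Space d)) (y : Space d → ℝ) (ψ : PathSpace d) (s : Space d) : ℝ≥0∞ :=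
  correctingFactor μY PX K y s * ENNReal.ofReal (ψ s)

/-- The Epanechnikov kernel `k(s) = (d + 2) / (2 c_d) (1 - ‖s‖²) 1_{B_1(o)}(s)`, where `c_d` is the
volume of the unit ball. -/
noncomputable def epanechnikov (d : ℕ) : Space d → ℝ :=
  (Metric.closedBall (0 : Space d) 1).indicator (fun s =>
    ((d : ℝ) + 2) / (2 * volume.real (Metric.closedBall (0 : Space d) 1)) * (1 - ‖s‖ ^ 2))

/-- The edge correction weight `c_D(t) = h⁻ᵈ ∫_D k((s - t) / h) ds`. -/
noncomputable def edgeWeight {d : ℕ} (h : ℝ) (D : Set (Space d)) (t : Space d) : ℝ≥0∞ :=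
  (ENNReal.ofReal (h ^ d))⁻¹ * ∫⁻ s in D, ENNReal.ofReal (epanechnikov d (h⁻¹ • (s - t)))

/-- The edge-corrected kernel estimator `h⁻ᵈ ∑_{t ∈ η ∩ D} c_D(t)⁻¹ k((s - t) / h)` built on a point
configuration `η`; the sum over the points of `η` in `D` is the integral over `D` with respect to
the counting measure `η`. -/
noncomputable def kernelEstimator {d : ℕ} (h : ℝ) (D : Set (Space d)) (η : Measure (Space d))
    (s : Space d) : ℝ≥0∞ :=
  (ENNReal.ofReal (h ^ d))⁻¹ *
    ∫⁻ t in D, (edgeWeight h D t)⁻¹ * ENNReal.ofReal (epanechnikov d (h⁻¹ • (s - t))) ∂η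

end CoxExtremal

/-! Integrate the estimator over `D` and exchange sum and integral: a centre `t ∈ D` with `c_D(t) ≠
0` contributes `c_D(t)⁻¹ c_D(t) = 1`, and one with `c_D(t) = 0` contributes nothing. So the total
mass is a count of contributing storms (`lintegral_kernelEstimator`), and the excluded centres form
a Lebesgue null part of `D` (`volume_edgeWeight_eq_zero`).

Unbiasedness is then Campbell's formula: the mean number of points in a set is its mean directing
measure. Since `{u | u⁻¹ ≤ r}` has severity mass `r` (`severityMeasure_inv_le`), integrating out `u`
turns the indicator of contribution into the supremum itself, whose mean is the correcting factor;
this gives the integral of `ψ_K^y` (`directingMeasure_marked`).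

With the threshold `Y*`, the set of marked points is random. Both sides of Campbell's formula define
measures in (intensity, threshold, storm). They agree on rectangles by the Poisson counts and
conditional independence, hence everywhere (`IsCoxProcess.lintegral_randomSet`). Intersecting with
events of `(Ψ, Y*)` gives the conditional statements.

Finiteness and measurability need `Y* > 0`. Near any point there is almost surely a storm whose
shape is positive on a ball covering the neighbourhood, because such storms have infinite directing
mass; the resulting lower bound on `Y` passes to `Y*` through equality in law. -/

namespace CoxExtremal

/-! ### Total mass and mean of the Poisson distribution -/

section Poisson

theorem tsum_poissonMeasure_singleton (r : ℝ≥0) : ∑' k : ℕ, poissonMeasure r {k} = 1 := by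
  have h := lintegral_countable' (μ := poissonMeasure r) (fun _ => 1)
  simpa using h.symm

/-- The term `k = 0` vanishes, and `(k + 1) · r^(k+1) / (k + 1)! = r · r^k / k!` leaves `r` times
the total mass. -/
theorem tsum_mul_poissonMeasure_singleton (r : ℝ≥0) :
    ∑' k : ℕ, (k : ℝ≥0∞) * poissonMeasure r {k} = r := by
  rw [tsum_eq_zero_add' ENNReal.summable]
  have h : ∀ k : ℕ, ((k + 1 : ℕ) : ℝ≥0∞) * poissonMeasure r {k + 1}
      = r * poissonMeasure r {k} := by
    intro k
    rw [poissonMeasure_singleton, poissonMeasure_singleton, ← ENNReal.ofReal_natCast,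
      ← ENNReal.ofReal_mul (by positivity), ← ENNReal.ofReal_coe_nnreal (p := r),
      ← ENNReal.ofReal_mul (by positivity)]
    congr 1
    rw [Nat.factorial_succ]
    push_cast
    field_simp
    ring
  simp_rw [h]
  rw [ENNReal.tsum_mul_left, tsum_poissonMeasure_singleton]
  simp

end Poisson

/-! ### Campbell's formula for Cox processes and random sets -/

section PointProcess

variable {Ω Z T S : Type*} [MeasurableSpace Ω] [MeasurableSpace Z] [MeasurableSpace T]
  [MeasurableSpace S] {P : Measure Ω}
  {Ψ : Ω → Z} {W : Ω → T} {p : ℕ → Ω → S} {κ : Kernel Z S}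

theorem measurable_pointProcess (hp : ∀ i, Measurable (p i)) : Measurable (pointProcess p) := by
  refine Measure.measurable_of_measurable_coe _ fun B hB => ?_
  simp only [pointProcess, Measure.sum_apply _ hB, Measure.dirac_apply' _ hB]
  exact Measurable.tsum fun i => (measurable_const.indicator hB).comp (hp i)

theorem measurable_pointProcess_apply (hp : ∀ i, Measurable (p i)) {B : Set S}
    (hB : MeasurableSet B) : Measurable fun ω => pointProcess p ω B :=
  (Measure.measurable_coe hB).comp (measurable_pointProcess hp)

/-- Conditional void and counting probabilities of a Cox process. -/
theorem IsCoxProcess.condProb_count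
    (hN : IsCoxProcess (MeasurableSpace.comap Ψ inferInstance) (pointProcess p)
      (fun ω => κ (Ψ ω)) P)
    {B : Set S} (hB : MeasurableSet B) (hfin : ∀ z, κ z B < ∞) (k : ℕ) :
    P⟦{ω | pointProcess p ω B = (k : ℝ≥0∞)} | MeasurableSpace.comap Ψ inferInstance⟧
      =ᵐ[P] fun ω => (poissonMeasure (κ (Ψ ω) B).toNNReal).real {k} := by
  have h := hN 1 (fun _ => B) (fun _ => k) (fun _ => hB)
    (fun i j hij => (hij (Subsingleton.elim i j)).elim)
  filter_upwards [h] with ω hω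
  have h2 := hω fun _ => hfin _
  simpa using h2

theorem measurable_poissonMeasure_real {B : Set S} (hB : MeasurableSet B) (k : ℕ) :
    Measurable fun z => (poissonMeasure (κ z B).toNNReal).real {k} := by
  simp_rw [poissonMeasure_real_singleton]
  have := κ.measurable_coe hB
  fun_prop

/-- Conditional independence, integrated over the events of the conditioning `σ`-algebra. -/
theorem CondIndependent.measure_inter {Ω : Type*} {m m₁ m₂ : MeasurableSpace Ω}
    [mΩ : MeasurableSpace Ω] {P : Measure Ω} [IsProbabilityMeasure P] (hm : m ≤ mΩ) (hm₁ : m₁ ≤ mΩ)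
    (hm₂ : m₂ ≤ mΩ) (hind : CondIndependent m m₁ m₂ P) {E A F : Set Ω} (hE : MeasurableSet[m] E)
    (hA : MeasurableSet[m₁] A) (hF : MeasurableSet[m₂] F) {g : Ω → ℝ} (hg : StronglyMeasurable[m] g)
    (hg0 : ∀ ω, 0 ≤ g ω) (hg1 : ∀ ω, g ω ≤ 1) (hgF : P⟦F | m⟧ =ᵐ[P] g) :
    P ((E ∩ A) ∩ F) = ∫⁻ ω in E ∩ A, ENNReal.ofReal (g ω) ∂P := by
  have hAm : MeasurableSet A := hm₁ _ hA
  have hFm : MeasurableSet F := hm₂ _ hF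
  have hgm : AEStronglyMeasurable g P := (hg.mono hm).aestronglyMeasurable
  have hgb : ∀ ω, ‖g ω‖ ≤ 1 := fun ω => by
    rw [Real.norm_of_nonneg (hg0 ω)]; exact hg1 ω
  have hi : Integrable (A.indicator (fun _ => (1 : ℝ))) P := (integrable_const _).indicator hAm
  have hgi : Integrable (g * A.indicator (fun _ => (1 : ℝ))) P :=
    hi.bdd_mul hgm (Filter.Eventually.of_forall hgb)
  -- Conditional independence factorizes the left side as `P⟦A | m⟧ * g`; since `g` is
  -- `m`-measurable it can be moved inside the conditional expectation.
  have h1 : P⟦A ∩ F | m⟧ =ᵐ[P] P[g * A.indicator (fun _ => (1 : ℝ)) | m] := by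
    filter_upwards [hind A F hA hF, hgF, condExp_mul_of_stronglyMeasurable_left (μ := P) hg hgi hi]
      with ω a b c
    rw [a, c, Pi.mul_apply, Pi.mul_apply, b, mul_comm]
  have h2 : ∫ ω in E, (A ∩ F).indicator (fun _ => (1 : ℝ)) ω ∂P
      = ∫ ω in E, (g * A.indicator (fun _ => (1 : ℝ))) ω ∂P := by
    rw [← setIntegral_condExp hm ((integrable_const _).indicator (hAm.inter hFm)) hE,
      ← setIntegral_condExp hm hgi hE]
    exact setIntegral_congr_ae (hm _ hE) (h1.mono fun ω hω _ => hω)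
  have h3 : g * A.indicator (fun _ => (1 : ℝ)) = A.indicator g := by
    ext ω
    by_cases hω : ω ∈ A <;> simp [hω]
  rw [h3, integral_indicator (hAm.inter hFm), integral_indicator hAm,
    Measure.restrict_restrict (hAm.inter hFm), Measure.restrict_restrict hAm] at h2
  have hgi : Integrable g (P.restrict (A ∩ E)) :=
    Integrable.of_bound hgm.restrict 1 (Filter.Eventually.of_forall hgb)
  have h4 := congrArg ENNReal.ofReal h2
  rw [ofReal_integral_eq_lintegral_ofReal hgi (Filter.Eventually.of_forall hg0)] at h4
  simp only [integral_const, MeasurableSet.univ, measureReal_restrict_apply, univ_inter,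
    smul_eq_mul, mul_one] at h4
  rw [ofReal_measureReal (measure_ne_top _ _)] at h4
  rw [inter_comm E, ← h4]
  congr 1
  ext ω
  simp only [mem_inter_iff]
  tauto

/-- The law of a count of a Cox process on events determined by the directing measure and by a
conditionally independent variable. -/
theorem IsCoxProcess.measure_inter_count [IsProbabilityMeasure P] (hΨ : Measurable Ψ)
    (hW : Measurable W) (hp : ∀ i, Measurable (p i))
    (hN : IsCoxProcess (MeasurableSpace.comap Ψ inferInstance) (pointProcess p)
      (fun ω => κ (Ψ ω)) P)
    (hind : CondIndependent (MeasurableSpace.comap Ψ inferInstance)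
      (MeasurableSpace.comap W inferInstance)
      (MeasurableSpace.comap (pointProcess p) inferInstance) P)
    {B : Set S} (hB : MeasurableSet B) (hfin : ∀ z, κ z B < ∞) (k : ℕ)
    {E : Set Z} (hE : MeasurableSet E) {A : Set T} (hA : MeasurableSet A) :
    P ((Ψ ⁻¹' E ∩ W ⁻¹' A) ∩ {ω | pointProcess p ω B = (k : ℝ≥0∞)})
      = ∫⁻ ω in Ψ ⁻¹' E ∩ W ⁻¹' A, poissonMeasure (κ (Ψ ω) B).toNNReal {k} ∂P := by
  have h := CondIndependent.measure_inter hΨ.comap_le hW.comap_le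
    (measurable_pointProcess hp).comap_le hind (E := Ψ ⁻¹' E) (A := W ⁻¹' A)
    ⟨E, hE, rfl⟩ ⟨A, hA, rfl⟩
    ⟨{ν | ν B = (k : ℝ≥0∞)}, Measure.measurable_coe hB (measurableSet_singleton _), rfl⟩
    ((measurable_poissonMeasure_real hB k).comp (comap_measurable Ψ)).stronglyMeasurable
    (fun _ => measureReal_nonneg) (fun _ => measureReal_le_one) (hN.condProb_count hB hfin k)
  simp only [Function.comp_def, ofReal_measureReal (measure_ne_top _ _)] at h
  exact h

/-- Campbell's formula for a Cox process on a rectangle. -/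
theorem IsCoxProcess.lintegral_count [IsProbabilityMeasure P] (hΨ : Measurable Ψ) (hW : Measurable W)
    (hp : ∀ i, Measurable (p i))
    (hN : IsCoxProcess (MeasurableSpace.comap Ψ inferInstance) (pointProcess p)
      (fun ω => κ (Ψ ω)) P)
    (hind : CondIndependent (MeasurableSpace.comap Ψ inferInstance)
      (MeasurableSpace.comap W inferInstance)
      (MeasurableSpace.comap (pointProcess p) inferInstance) P)
    {B : Set S} (hB : MeasurableSet B) (hfin : ∀ z, κ z B < ∞)
    {E : Set Z} (hE : MeasurableSet E) {A : Set T} (hA : MeasurableSet A) :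
    ∫⁻ ω in Ψ ⁻¹' E ∩ W ⁻¹' A, pointProcess p ω B ∂P
      = ∫⁻ ω in Ψ ⁻¹' E ∩ W ⁻¹' A, κ (Ψ ω) B ∂P := by
  have hpois : ∀ k : ℕ, Measurable fun ω => poissonMeasure (κ (Ψ ω) B).toNNReal {k} := by
    intro k
    have h := ((measurable_poissonMeasure_real (κ := κ) hB k).comp hΨ).ennreal_ofReal
    simpa only [Function.comp_def, ofReal_measureReal (measure_ne_top _ _)] using h
  have hcm := measurable_pointProcess_apply hp hB
  have hFm : ∀ k : ℕ, MeasurableSet {ω | pointProcess p ω B = (k : ℝ≥0∞)} :=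
    fun k => hcm (measurableSet_singleton _)
  have hdisj : Pairwise (Function.onFun Disjoint
      fun k : ℕ => {ω | pointProcess p ω B = (k : ℝ≥0∞)}) := by
    intro i j hij
    refine Set.disjoint_left.2 fun ω hi hj => hij ?_
    exact_mod_cast (show (i : ℝ≥0∞) = j from hi.symm.trans hj)
  -- The count is almost surely a finite integer, since its Poisson probabilities sum to one. The
  -- value `∞` thus costs nothing below.
  have hae : ∀ᵐ ω ∂P, ω ∈ ⋃ k : ℕ, {ω | pointProcess p ω B = (k : ℝ≥0∞)} := by
    refine (mem_ae_iff_prob_eq_one (MeasurableSet.iUnion hFm)).2 ?_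
    rw [measure_iUnion hdisj hFm]
    have h := fun k : ℕ => hN.measure_inter_count hΨ hW hp hind hB hfin k
      MeasurableSet.univ MeasurableSet.univ
    simp only [preimage_univ, inter_univ, univ_inter, Measure.restrict_univ] at h
    simp_rw [h]
    rw [← lintegral_tsum fun k => (hpois k).aemeasurable]
    simp [tsum_poissonMeasure_singleton]
  have hsum : ∀ᵐ ω ∂P, pointProcess p ω B
      = ∑' k : ℕ, {ω | pointProcess p ω B = (k : ℝ≥0∞)}.indicator (fun _ => (k : ℝ≥0∞)) ω := by
    filter_upwards [hae] with ω hω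
    obtain ⟨k, hk⟩ := mem_iUnion.1 hω
    rw [tsum_eq_single k, indicator_of_mem hk]
    · exact hk
    · intro j hj
      refine indicator_of_notMem (fun hj' => hj ?_) _
      exact_mod_cast (show (j : ℝ≥0∞) = k from hj'.symm.trans hk)
  rw [lintegral_congr_ae (ae_restrict_of_ae hsum),
    lintegral_tsum fun k => (measurable_const.indicator (hFm k)).aemeasurable]
  have hk : ∀ k : ℕ, ∫⁻ ω in Ψ ⁻¹' E ∩ W ⁻¹' A,
      {ω | pointProcess p ω B = (k : ℝ≥0∞)}.indicator (fun _ => (k : ℝ≥0∞)) ω ∂P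
      = ∫⁻ ω in Ψ ⁻¹' E ∩ W ⁻¹' A, k * poissonMeasure (κ (Ψ ω) B).toNNReal {k} ∂P := by
    intro k
    rw [lintegral_indicator_const (hFm k), Measure.restrict_apply (hFm k), inter_comm,
      hN.measure_inter_count hΨ hW hp hind hB hfin k hE hA, lintegral_const_mul _ (hpois k)]
  simp_rw [hk]
  rw [← lintegral_tsum fun k => ((hpois k).const_mul _).aemeasurable]
  refine lintegral_congr fun ω => ?_
  rw [tsum_mul_poissonMeasure_singleton, ENNReal.coe_toNNReal (hfin _).ne]

/-- Campbell's formula for a Cox process and a variable that is conditionally independent of it: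
the mean number of points in a random set is the mean directing measure of this set. -/
theorem IsCoxProcess.lintegral_randomSet [IsProbabilityMeasure P] [IsSFiniteKernel κ] (hΨ : Measurable Ψ)
    (hW : Measurable W) (hp : ∀ i, Measurable (p i))
    (hN : IsCoxProcess (MeasurableSpace.comap Ψ inferInstance) (pointProcess p)
      (fun ω => κ (Ψ ω)) P)
    (hind : CondIndependent (MeasurableSpace.comap Ψ inferInstance)
      (MeasurableSpace.comap W inferInstance)
      (MeasurableSpace.comap (pointProcess p) inferInstance) P)
    {B : ℕ → Set S} (hB : ∀ n, MeasurableSet (B n)) (hfin : ∀ n z, κ z (B n) < ∞)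
    (hcover : ⋃ n, B n = univ) {G : Set (Z × T × S)} (hG : MeasurableSet G) :
    ∫⁻ ω, pointProcess p ω {q | (Ψ ω, W ω, q) ∈ G} ∂P
      = ∫⁻ ω, κ (Ψ ω) {q | (Ψ ω, W ω, q) ∈ G} ∂P := by
  have hΨW : Measurable fun ω => (Ψ ω, W ω) := hΨ.prodMk hW
  have hmk : ∀ i, Measurable fun ω => (Ψ ω, W ω, p i ω) :=
    fun i => hΨ.prodMk (hW.prodMk (hp i))
  have hsec : ∀ {G : Set (Z × T × S)}, MeasurableSet G → ∀ ω,
      MeasurableSet {q | (Ψ ω, W ω, q) ∈ G} := fun hG ω =>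
    (measurable_const.prodMk (measurable_const.prodMk measurable_id)) hG
  -- The two sides of the claim, as functions of `G`, are the measures `M₁` and `M₂`; it remains to
  -- identify these.
  set M₁ : Measure (Z × T × S) := Measure.sum fun i => P.map fun ω => (Ψ ω, W ω, p i ω) with hM₁
  set M₂ : Measure (Z × T × S) :=
    ((P.map fun ω => (Ψ ω, W ω)) ⊗ₘ (κ.prodMkRight T)).map MeasurableEquiv.prodAssoc with hM₂
  have e₁ : ∀ G : Set (Z × T × S), MeasurableSet G →
      M₁ G = ∫⁻ ω, pointProcess p ω {q | (Ψ ω, W ω, q) ∈ G} ∂P := by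
    intro G hG
    simp only [hM₁, pointProcess]
    rw [Measure.sum_apply _ hG]
    simp_rw [fun ω => Measure.sum_apply (fun i => Measure.dirac (p i ω)) (hsec hG ω)]
    have hd : ∀ i ω, Measure.dirac (p i ω) {q | (Ψ ω, W ω, q) ∈ G}
        = ((fun ω => (Ψ ω, W ω, p i ω)) ⁻¹' G).indicator 1 ω := by
      intro i ω
      rw [Measure.dirac_apply' _ (hsec hG ω)]
      rfl
    simp_rw [hd]
    rw [lintegral_tsum fun i => (measurable_one.indicator (hmk i hG)).aemeasurable]
    congr 1
    ext i
    rw [lintegral_indicator_one (hmk i hG), Measure.map_apply (hmk i) hG]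
  have e₂ : ∀ G : Set (Z × T × S), MeasurableSet G →
      M₂ G = ∫⁻ ω, κ (Ψ ω) {q | (Ψ ω, W ω, q) ∈ G} ∂P := by
    intro G hG
    rw [hM₂, MeasurableEquiv.map_apply, Measure.compProd_apply
      (MeasurableEquiv.prodAssoc.measurable hG), lintegral_map
      (Kernel.measurable_kernel_prodMk_left (MeasurableEquiv.prodAssoc.measurable hG)) hΨW]
    rfl
  suffices h : M₁ = M₂ by rw [← e₁ G hG, ← e₂ G hG, h]
  -- Uniqueness from rectangles needs finite measures. `κ z (B n)` is finite for each `z` but not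
  -- bounded in `z`, hence the second index, which caps it by `k`.
  set U : ℕ × ℕ → Set (Z × T × S) :=
    fun nk => {z | κ z (B nk.1) ≤ (nk.2 : ℝ≥0∞)} ×ˢ univ ×ˢ B nk.1 with hU
  have hz : ∀ nk : ℕ × ℕ, MeasurableSet {z | κ z (B nk.1) ≤ (nk.2 : ℝ≥0∞)} :=
    fun nk => measurableSet_le (κ.measurable_coe (hB _)) measurable_const
  have hUm : ∀ nk, MeasurableSet (U nk) :=
    fun nk => (hz nk).prod (MeasurableSet.univ.prod (hB _))
  have hUu : ⋃ nk, U nk = univ := by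
    refine eq_univ_of_forall fun ⟨z, w, q⟩ => ?_
    obtain ⟨n, hn⟩ := mem_iUnion.1 (hcover ▸ mem_univ q : q ∈ ⋃ n, B n)
    obtain ⟨k, hk⟩ := ENNReal.exists_nat_gt (hfin n z).ne
    exact mem_iUnion.2 ⟨(n, k), hk.le, mem_univ _, hn⟩
  have rect : ∀ (nk : ℕ × ℕ) {E : Set Z} {A : Set T} {C : Set S}, MeasurableSet E →
      MeasurableSet A → MeasurableSet C →
      M₁.restrict (U nk) (E ×ˢ A ×ˢ C) = M₂.restrict (U nk) (E ×ˢ A ×ˢ C) := by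
    intro nk E A C hE hA hC
    have hm := hE.prod (hA.prod hC)
    have hset : E ×ˢ A ×ˢ C ∩ U nk
        = (E ∩ {z | κ z (B nk.1) ≤ (nk.2 : ℝ≥0∞)}) ×ˢ A ×ˢ (C ∩ B nk.1) := by
      rw [hU, prod_inter_prod, prod_inter_prod, inter_univ]
    rw [Measure.restrict_apply hm, Measure.restrict_apply hm, hset]
    have hE' := hE.inter (hz nk)
    have hC' := hC.inter (hB nk.1)
    generalize E ∩ {z | κ z (B nk.1) ≤ (nk.2 : ℝ≥0∞)} = E' at hE'
    have hCfin : ∀ z, κ z (C ∩ B nk.1) < ∞ :=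
      fun z => (measure_mono inter_subset_right).trans_lt (hfin nk.1 z)
    generalize C ∩ B nk.1 = C' at hC' hCfin
    rw [e₁ _ (hE'.prod (hA.prod hC')), e₂ _ (hE'.prod (hA.prod hC'))]
    have hind : ∀ (ν : Ω → Measure S) (ω : Ω),
        ν ω {q | (Ψ ω, W ω, q) ∈ E' ×ˢ A ×ˢ C'}
          = (Ψ ⁻¹' E' ∩ W ⁻¹' A).indicator (fun ω => ν ω C') ω := by
      intro ν ω
      by_cases hω : ω ∈ Ψ ⁻¹' E' ∩ W ⁻¹' A
      · rw [indicator_of_mem hω]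
        congr 1
        ext q
        simp [mem_preimage.1 hω.1, mem_preimage.1 hω.2]
      · rw [indicator_of_notMem hω]
        convert measure_empty (μ := ν ω)
        ext q
        simp only [mem_ofPred_eq, mem_prod, mem_empty_iff_false, iff_false]
        exact fun h => hω ⟨h.1, h.2.1⟩
    rw [lintegral_congr (hind (pointProcess p)), lintegral_congr (hind fun ω => κ (Ψ ω)),
      lintegral_indicator ((hΨ hE').inter (hW hA)), lintegral_indicator ((hΨ hE').inter (hW hA))]
    exact hN.lintegral_count hΨ hW hp ‹_› hC' hCfin hE' hA
  refine (Measure.ext_iff_of_iUnion_eq_univ hUu).2 fun nk => ?_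
  -- Finiteness is read off from `M₂`, where the cap applies, through the agreement on the full
  -- rectangle.
  have hfinite : IsFiniteMeasure (M₁.restrict (U nk)) := by
    constructor
    have h := rect nk (E := univ) (A := univ) (C := univ) .univ .univ .univ
    rw [univ_prod_univ, univ_prod_univ] at h
    rw [h, Measure.restrict_apply .univ, univ_inter, e₂ _ (hUm nk)]
    refine (lintegral_mono (g := fun _ => (nk.2 : ℝ≥0∞)) fun ω => ?_).trans_lt (by simp)
    by_cases hω : κ (Ψ ω) (B nk.1) ≤ (nk.2 : ℝ≥0∞)
    · exact (measure_mono fun q hq => hq.2.2).trans hω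
    · have h0 : {q | (Ψ ω, W ω, q) ∈ U nk} = ∅ :=
        eq_empty_of_forall_notMem fun q hq => hω hq.1
      simp [h0]
  exact Measure.ext_prod₃ (rect nk)

end PointProcess

end CoxExtremal

namespace CoxExtremal

/-! ### The severity measure -/

section Severity

instance : SFinite severityMeasure := by
  unfold severityMeasure
  infer_instance

theorem severityMeasure_apply {B : Set ℝ≥0∞} (hB : MeasurableSet B) :
    severityMeasure B
      = ∫⁻ u in Ioi (0 : ℝ) ∩ ENNReal.ofReal ⁻¹' B, ENNReal.ofReal ((u ^ 2)⁻¹) := by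
  have hB' := ENNReal.measurable_ofReal hB
  rw [severityMeasure, Measure.map_apply ENNReal.measurable_ofReal hB, withDensity_apply _ hB',
    Measure.restrict_restrict hB', inter_comm]

theorem lintegral_Ici_sq_inv {a : ℝ} (ha : 0 < a) :
    ∫⁻ u in Ici a, ENNReal.ofReal ((u ^ 2)⁻¹) = ENNReal.ofReal a⁻¹ := by
  have hcongr : ∫⁻ u in Ioi a, ENNReal.ofReal ((u ^ 2)⁻¹)
      = ∫⁻ u in Ioi a, ENNReal.ofReal (u ^ (-2 : ℝ)) := by
    refine setLIntegral_congr_fun measurableSet_Ioi fun u hu => ?_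
    have hu0 : 0 < u := ha.trans hu
    rw [Real.rpow_neg hu0.le, Real.rpow_two]
  rw [← restrict_Ioi_eq_restrict_Ici, hcongr, ← ofReal_integral_eq_lintegral_ofReal
    (integrableOn_Ioi_rpow_of_lt (by norm_num) ha), integral_Ioi_rpow_of_lt (by norm_num) ha]
  · congr 1
    norm_num
    rw [Real.rpow_neg_one]
  · filter_upwards [ae_restrict_mem measurableSet_Ioi] with u hu
    exact Real.rpow_nonneg (ha.trans hu).le _

theorem measurableSet_inv_le (r : ℝ≥0∞) : MeasurableSet {u : ℝ≥0∞ | u⁻¹ ≤ r} :=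
  measurableSet_le measurable_inv measurable_const

theorem severityMeasure_inv_le_ofReal {r : ℝ} (hr : 0 < r) :
    severityMeasure {u | u⁻¹ ≤ ENNReal.ofReal r} = ENNReal.ofReal r := by
  rw [severityMeasure_apply (measurableSet_inv_le _)]
  have h : Ioi (0 : ℝ) ∩ ENNReal.ofReal ⁻¹' {u | u⁻¹ ≤ ENNReal.ofReal r} = Ici r⁻¹ := by
    ext u
    simp only [mem_inter_iff, mem_Ioi, mem_preimage, mem_ofPred_eq, mem_Ici]
    constructor
    · rintro ⟨hu, h⟩
      rw [← ENNReal.ofReal_inv_of_pos hu, ENNReal.ofReal_le_ofReal_iff hr.le] at h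
      exact (inv_le_comm₀ hu hr).1 h
    · intro h
      have hu : 0 < u := (inv_pos.2 hr).trans_le h
      refine ⟨hu, ?_⟩
      rw [← ENNReal.ofReal_inv_of_pos hu, ENNReal.ofReal_le_ofReal_iff hr.le]
      exact (inv_le_comm₀ hr hu).1 h
  rw [h, lintegral_Ici_sq_inv (inv_pos.2 hr), inv_inv]

/-- The tail of `u⁻² du` beyond `1/r` has mass `r`. This normalization is what makes the correcting
factor a plain mean of suprema. -/
theorem severityMeasure_inv_le (r : ℝ≥0∞) : severityMeasure {u | u⁻¹ ≤ r} = r := by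
  rcases eq_or_ne r ∞ with rfl | hr
  -- For `r = ∞` the set is everything and the total mass is infinite; `x + 1` keeps the real level
  -- positive when `x = 0`.
  · refine ENNReal.eq_top_of_forall_nnreal_le fun x => ?_
    calc (x : ℝ≥0∞) ≤ ENNReal.ofReal (x + 1) := by
          rw [← ENNReal.ofReal_coe_nnreal]
          exact ENNReal.ofReal_le_ofReal (by linarith)
      _ = severityMeasure {u | u⁻¹ ≤ ENNReal.ofReal (x + 1)} :=
          (severityMeasure_inv_le_ofReal (by positivity)).symm
      _ ≤ _ := measure_mono fun u _ => (le_top : u⁻¹ ≤ ∞)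
  rcases eq_or_ne r 0 with rfl | h0
  · rw [severityMeasure_apply (measurableSet_inv_le _)]
    have h : Ioi (0 : ℝ) ∩ ENNReal.ofReal ⁻¹' {u | u⁻¹ ≤ 0} = ∅ := by
      refine eq_empty_of_forall_notMem fun u hu => ?_
      have := hu.2
      simp at this
    rw [h]
    simp
  · rw [← ENNReal.ofReal_toReal hr]
    exact severityMeasure_inv_le_ofReal (ENNReal.toReal_pos h0 hr)

theorem severityMeasure_singleton_zero : severityMeasure {0} = 0 := by
  rw [severityMeasure_apply (measurableSet_singleton _)]
  have h : Ioi (0 : ℝ) ∩ ENNReal.ofReal ⁻¹' {0} = ∅ := by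
    refine eq_empty_of_forall_notMem fun u hu => ?_
    have h1 : 0 < u := hu.1
    have h2 : ENNReal.ofReal u = 0 := hu.2
    exact absurd (ENNReal.ofReal_eq_zero.1 h2) (not_le.2 h1)
  rw [h]
  simp

end Severity

/-! ### The Epanechnikov kernel and its edge correction -/

section Epanechnikov

variable {d : ℕ}

theorem measurable_epanechnikov : Measurable (epanechnikov d) := by
  unfold epanechnikov
  exact Measurable.indicator (by fun_prop) Metric.isClosed_closedBall.measurableSet

theorem epanechnikov_pos {s : Space d} (hs : ‖s‖ < 1) : 0 < epanechnikov d s := by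
  have hv : 0 < volume.real (Metric.closedBall (0 : Space d) 1) :=
    ENNReal.toReal_pos (Metric.measure_closedBall_pos volume _ one_pos).ne'
      measure_closedBall_lt_top.ne
  rw [epanechnikov, indicator_of_mem (by simpa using hs.le)]
  have : 0 < 1 - ‖s‖ ^ 2 := by nlinarith [norm_nonneg s]
  positivity

theorem epanechnikov_le (s : Space d) : epanechnikov d s
    ≤ ((d : ℝ) + 2) / (2 * volume.real (Metric.closedBall (0 : Space d) 1)) := by
  unfold epanechnikov
  refine indicator_apply_le' (fun _ => ?_) fun _ => by positivity
  exact mul_le_of_le_one_right (by positivity) (by nlinarith [sq_nonneg ‖s‖])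

theorem measurable_epanechnikov_scaled (h : ℝ) :
    Measurable fun z : Space d × Space d =>
      ENNReal.ofReal (epanechnikov d (h⁻¹ • (z.1 - z.2))) := by
  have := measurable_epanechnikov (d := d)
  fun_prop

theorem measurable_edgeWeight (h : ℝ) (D : Set (Space d)) : Measurable (edgeWeight h D) :=
  ((measurable_epanechnikov_scaled h).lintegral_prod_left (μ := volume.restrict D)).const_mul _

theorem edgeWeight_lt_top {h : ℝ} (hh : 0 < h) {D : Set (Space d)} (hD : volume D < ∞)
    (t : Space d) : edgeWeight h D t < ∞ := by
  refine ENNReal.mul_lt_top (by simp [pow_pos hh]) ?_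
  refine (lintegral_mono fun s => ENNReal.ofReal_le_ofReal (epanechnikov_le _)).trans_lt ?_
  rw [setLIntegral_const]
  exact ENNReal.mul_lt_top ENNReal.ofReal_lt_top hD

/-- The scaled kernel is positive on the open ball of radius `h` about `t`, so a zero weight at `t`
makes `D` null in that ball. The set is therefore locally null, hence null. -/
theorem volume_edgeWeight_eq_zero {h : ℝ} (hh : 0 < h) {D : Set (Space d)}
    (hD : MeasurableSet D) : volume ({t | edgeWeight h D t = 0} ∩ D) = 0 := by
  refine measure_null_of_locally_null _ fun t ht => ?_
  refine ⟨({t | edgeWeight h D t = 0} ∩ D) ∩ Metric.ball t h,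
    Filter.inter_mem self_mem_nhdsWithin (mem_nhdsWithin_of_mem_nhds (Metric.ball_mem_nhds t hh)), ?_⟩
  have hz : ∫⁻ s in D, ENNReal.ofReal (epanechnikov d (h⁻¹ • (s - t))) = 0 := by
    refine (mul_eq_zero.1 ht.1).resolve_left ?_
    simp
  have hm : Measurable fun s : Space d => ENNReal.ofReal (epanechnikov d (h⁻¹ • (s - t))) := by
    have := measurable_epanechnikov (d := d)
    fun_prop
  rw [lintegral_eq_zero_iff hm, Filter.EventuallyEq, ae_restrict_iff' hD] at hz
  refine measure_mono_null (fun s hs => ?_) hz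
  intro hs'
  have h1 := hs' hs.1.2
  have h2 : 0 < epanechnikov d (h⁻¹ • (s - t)) := by
    refine epanechnikov_pos ?_
    rw [norm_smul, norm_inv, Real.norm_of_nonneg hh.le, inv_mul_lt_iff₀ hh, mul_one,
      ← dist_eq_norm]
    exact hs.2
  exact absurd (ENNReal.ofReal_eq_zero.1 h1) (not_le.2 h2)

/-- Tonelli: for fixed `t` the inner integral is `(w t)⁻¹ * w t`, that is `1` wherever the weight
does not vanish. -/
theorem lintegral_normalized_kernel {α : Type*} [MeasurableSpace α] {μ η : Measure α} [SFinite μ]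
    [SFinite η] {c : ℝ≥0∞} (hc : c ≠ ∞) {k : α → α → ℝ≥0∞} (hk : Measurable (Function.uncurry k))
    {w : α → ℝ≥0∞} (hw : ∀ t, w t = c * ∫⁻ s, k s t ∂μ) (hfin : ∀ t, w t ≠ ∞) :
    ∫⁻ s, c * ∫⁻ t, (w t)⁻¹ * k s t ∂η ∂μ = η {t | w t ≠ 0} := by
  have hwm : Measurable w := by
    have : w = fun t => c * ∫⁻ s, k s t ∂μ := funext hw
    rw [this]
    exact (hk.lintegral_prod_left').const_mul c
  have hf : Measurable (Function.uncurry fun s t => (w t)⁻¹ * k s t) :=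
    (hwm.comp measurable_snd).inv.mul hk
  rw [lintegral_const_mul' _ _ hc, lintegral_lintegral_swap hf.aemeasurable,
    ← lintegral_const_mul' _ _ hc]
  have hm : MeasurableSet {t | w t ≠ 0} := (hwm (measurableSet_singleton 0)).compl
  have he : ∀ t, c * ∫⁻ s, (w t)⁻¹ * k s t ∂μ = {t | w t ≠ 0}.indicator 1 t := by
    intro t
    have hkt : Measurable fun s => k s t := hk.comp (measurable_id.prodMk measurable_const)
    rw [lintegral_const_mul _ hkt, mul_left_comm, ← hw]
    -- At zero weight the convention `∞ * 0 = 0` discards the point.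
    by_cases h0 : w t = 0
    · simp [h0]
    · rw [ENNReal.inv_mul_cancel h0 (hfin t), indicator_of_mem (show t ∈ {t | w t ≠ 0} from h0)]
      rfl
  rw [lintegral_congr he, lintegral_indicator_one hm]

/-- The edge correction makes the total mass of the kernel estimator on `D` the number of points in
`D`, up to points with null edge weight. -/
theorem lintegral_kernelEstimator {h : ℝ} (hh : 0 < h) {D : Set (Space d)}
    (hDfin : volume D < ∞) (η : Measure (Space d)) [SFinite η] :
    ∫⁻ s in D, kernelEstimator h D η s = η ({t | edgeWeight h D t ≠ 0} ∩ D) := by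
  have hm : MeasurableSet {t | edgeWeight h D t ≠ 0} :=
    (measurable_edgeWeight h D (measurableSet_singleton 0)).compl
  rw [← Measure.restrict_apply hm]
  exact lintegral_normalized_kernel (by simp [pow_pos hh])
    (measurable_epanechnikov_scaled (d := d) h) (fun _ => rfl)
    (fun t => (edgeWeight_lt_top hh hDfin t).ne)

end Epanechnikov

end CoxExtremal

namespace CoxExtremal

variable {d : ℕ}

/-! ### Suprema over a countable dense subset -/

section SupRatio

theorem supRatio_mono {K Q : Set (Space d)} (hQK : Q ⊆ K) (y : Space d → ℝ) (s : Space d)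
    (x : PathSpace d) : supRatio Q y s x ≤ supRatio K y s x :=
  biSup_mono fun _ ht => hQK ht

/-- The ratio is continuous on `K` because `y` is continuous and positive there. Passing to a
countable `Q` makes the supremum measurable jointly in threshold, centre and shape. -/
theorem supRatio_eq_of_dense {K Q : Set (Space d)} (hQK : Q ⊆ K) (hKQ : K ⊆ closure Q)
    {y : Space d → ℝ} (hy : ContinuousOn y K) (hpos : ∀ t ∈ K, 0 < y t) :
    supRatio K y = supRatio Q y := by
  ext s x
  refine le_antisymm (iSup₂_le fun t ht => ?_) (supRatio_mono hQK y s x)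
  have hc : ContinuousOn (fun t => ENNReal.ofReal (x (t - s) / y t)) K :=
    ENNReal.continuous_ofReal.comp_continuousOn
      ((Continuous.continuousOn (by fun_prop)).div hy fun t ht => (hpos t ht).ne')
  rw [← ENNReal.ofReal_div_of_pos (hpos t ht)]
  have : (nhdsWithin t Q).NeBot := mem_closure_iff_nhdsWithin_neBot.1 (hKQ ht)
  refine le_of_tendsto ((hc t ht).mono hQK) ?_
  filter_upwards [self_mem_nhdsWithin] with t' ht'
  rw [ENNReal.ofReal_div_of_pos (hpos t' (hQK ht'))]
  exact le_iSup₂ (f := fun t _ => ENNReal.ofReal (x (t - s)) / ENNReal.ofReal (y t)) t' ht'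

theorem measurable_eval_path {α : Type*} [MeasurableSpace α] {x : α → PathSpace d}
    {s : α → Space d} (hx : Measurable x) (hs : Measurable s) : Measurable fun a => x a (s a) := by
  have h : Continuous fun z : PathSpace d × Space d => z.1 z.2 := by fun_prop
  exact h.measurable.comp (hx.prodMk hs)

theorem measurable_supRatio {α : Type*} [MeasurableSpace α] {Q : Set (Space d)}
    (hQ : Q.Countable) {y : α → Space d → ℝ} (hy : ∀ t, Measurable fun a => y a t)
    {s : α → Space d} (hs : Measurable s) {x : α → PathSpace d} (hx : Measurable x) :
    Measurable fun a => supRatio Q (y a) (s a) (x a) := by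
  refine Measurable.biSup Q hQ fun t _ => ?_
  exact (measurable_eval_path hx (measurable_const.sub hs)).ennreal_ofReal.div
    (hy t).ennreal_ofReal

end SupRatio

/-! ### The directing measure as a kernel -/

section Directing

/-- The directing measure as a kernel from the realizations of the spatial intensity. -/
noncomputable def directingKernel (μY : ℝ) (PX : Measure (PathSpace d)) [SFinite PX] :
    Kernel (PathSpace d) (Storm d) :=
  Kernel.withDensity (Kernel.const _ ((volume : Measure (Space d)).prod (severityMeasure.prod PX)))
    (fun ψ q => ((μY.toNNReal⁻¹ * (ψ q.1).toNNReal : ℝ≥0) : ℝ≥0∞))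

/-- The density is written with values in `ℝ≥0` so that finiteness gives s-finiteness. -/
instance (μY : ℝ) (PX : Measure (PathSpace d)) [SFinite PX] :
    IsSFiniteKernel (directingKernel μY PX) := by
  unfold directingKernel
  infer_instance

theorem directingKernel_apply {μY : ℝ} (hμY : 0 < μY) (PX : Measure (PathSpace d)) [SFinite PX]
    (ψ : PathSpace d) : directingKernel μY PX ψ = directingMeasure μY PX ψ := by
  have hm : Measurable fun z : PathSpace d × Storm d => (z.1 z.2.1).toNNReal :=
    (measurable_eval_path measurable_fst measurable_snd.fst).real_toNNReal
  have hψ : Measurable fun s => ENNReal.ofReal (ψ s) := ψ.continuous.measurable.ennreal_ofReal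
  rw [directingKernel, Kernel.withDensity_apply _ (hm.const_mul _).coe_nnreal_ennreal,
    Kernel.const_apply, directingMeasure, prod_withDensity_left hψ, ← withDensity_smul _
    (f := fun z : Storm d => ENNReal.ofReal (ψ z.1)) (hψ.comp measurable_fst)]
  congr 1
  ext q
  rw [ENNReal.coe_mul, ENNReal.coe_inv (by simpa using hμY)]
  rfl

theorem directingMeasure_apply (μY : ℝ) (PX : Measure (PathSpace d)) [SFinite PX]
    (ψ : PathSpace d) {B : Set (Storm d)} (hB : MeasurableSet B) :
    directingMeasure μY PX ψ B = (ENNReal.ofReal μY)⁻¹ *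
      ∫⁻ s, ENNReal.ofReal (ψ s) * severityMeasure.prod PX (Prod.mk s ⁻¹' B) := by
  rw [directingMeasure, Measure.smul_apply, smul_eq_mul, Measure.prod_apply hB,
    lintegral_withDensity_eq_lintegral_mul _ ψ.continuous.measurable.ennreal_ofReal
      (measurable_measure_prodMk_left hB)]
  rfl

theorem lintegral_path_lt_top (ψ : PathSpace d) {D : Set (Space d)} (hD : IsCompact D) :
    ∫⁻ s in D, ENNReal.ofReal (ψ s) < ∞ :=
  Integrable.lintegral_lt_top (ψ.continuous.continuousOn.integrableOn_compact hD)

theorem measurableSet_marked {D : Set (Space d)} (hD : MeasurableSet D) {Q : Set (Space d)}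
    (hQ : Q.Countable) (y : Space d → ℝ) :
    MeasurableSet {q : Storm d | q.1 ∈ D ∧ q.2.1⁻¹ ≤ supRatio Q y q.1 q.2.2} := by
  have h₁ : Measurable fun q : Storm d => supRatio Q y q.1 q.2.2 :=
    measurable_supRatio hQ (y := fun _ => y) (fun _ => measurable_const) measurable_fst
      measurable_snd.snd
  have h₂ : Measurable fun q : Storm d => q.2.1⁻¹ := measurable_snd.fst.inv
  have h₃ : MeasurableSet {q : Storm d | q.1 ∈ D} := measurable_fst hD
  exact h₃.inter (measurableSet_le h₂ h₁)

/-- The mean number of storms contributing on `Q` with centre in `D`. -/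
theorem directingMeasure_marked {μY : ℝ} (hμY : 0 < μY) (PX : Measure (PathSpace d)) [SFinite PX]
    (ψ : PathSpace d) {D : Set (Space d)} (hD : MeasurableSet D) {Q : Set (Space d)}
    (hQ : Q.Countable) (y : Space d → ℝ) :
    directingMeasure μY PX ψ {q | q.1 ∈ D ∧ q.2.1⁻¹ ≤ supRatio Q y q.1 q.2.2}
      = ∫⁻ s in D, contributingIntensity μY PX Q y ψ s := by
  have hmk := measurableSet_marked hD hQ y
  have hc : (ENNReal.ofReal μY)⁻¹ ≠ ∞ := by simp [hμY]
  have hsec : ∀ s, severityMeasure.prod PX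
      (Prod.mk s ⁻¹' {q : Storm d | q.1 ∈ D ∧ q.2.1⁻¹ ≤ supRatio Q y q.1 q.2.2})
      = D.indicator (fun s => ∫⁻ x, supRatio Q y s x ∂PX) s := by
    intro s
    rw [Measure.prod_apply_symm (measurable_prodMk_left hmk)]
    by_cases hs : s ∈ D
    · rw [indicator_of_mem hs]
      refine lintegral_congr fun x => ?_
      rw [← severityMeasure_inv_le (supRatio Q y s x)]
      congr 1
      ext u
      simp [hs]
    · rw [indicator_of_notMem hs]
      simp [hs]
  rw [directingMeasure_apply _ _ _ hmk, ← lintegral_const_mul' _ _ hc, ← lintegral_indicator hD]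
  refine lintegral_congr fun s => ?_
  rw [hsec]
  by_cases hs : s ∈ D
  · simp only [indicator_of_mem hs, contributingIntensity, correctingFactor]
    ring
  · simp [indicator_of_notMem hs]

theorem directingMeasure_prod {μY : ℝ} (PX : Measure (PathSpace d)) [SFinite PX]
    (ψ : PathSpace d) {D : Set (Space d)} (hD : MeasurableSet D) (U : Set ℝ≥0∞)
    (V : Set (PathSpace d)) :
    directingMeasure μY PX ψ (D ×ˢ U ×ˢ V) = (ENNReal.ofReal μY)⁻¹ *
      ((∫⁻ s in D, ENNReal.ofReal (ψ s)) * (severityMeasure U * PX V)) := by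
  rw [directingMeasure, Measure.smul_apply, Measure.prod_prod, Measure.prod_prod,
    withDensity_apply _ hD, smul_eq_mul]

/-- The storms with centres in a ball and severities bounded away from zero. -/
def stormWindow (d n : ℕ) : Set (Storm d) :=
  Metric.closedBall (0 : Space d) n ×ˢ ({u : ℝ≥0∞ | u⁻¹ ≤ n} ∪ {0}) ×ˢ univ

theorem measurableSet_severityWindow (n : ℕ) :
    MeasurableSet ({u : ℝ≥0∞ | u⁻¹ ≤ n} ∪ {0}) :=
  (measurableSet_inv_le n).union (measurableSet_singleton 0)

theorem measurableSet_stormWindow (n : ℕ) : MeasurableSet (stormWindow d n) :=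
  Metric.isClosed_closedBall.measurableSet.prod ((measurableSet_severityWindow n).prod .univ)

/-- The severity `0` belongs to the space of storms and satisfies no bound `u⁻¹ ≤ n`; the windows
contain it, at no cost in mass, in order to cover. -/
theorem iUnion_stormWindow : ⋃ n, stormWindow d n = univ := by
  refine eq_univ_of_forall fun ⟨s, u, x⟩ => ?_
  obtain ⟨n, hn⟩ := exists_nat_ge ‖s‖
  rcases eq_or_ne u 0 with rfl | hu
  · exact mem_iUnion.2 ⟨n, by simpa using hn, Or.inr rfl, mem_univ _⟩
  · obtain ⟨k, hk⟩ := ENNReal.exists_nat_gt (ENNReal.inv_ne_top.2 hu)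
    refine mem_iUnion.2 ⟨max n k, ?_, Or.inl ?_, mem_univ _⟩
    · have : (n : ℝ) ≤ (max n k : ℕ) := by exact_mod_cast le_max_left n k
      simpa using hn.trans this
    · have : (k : ℝ≥0∞) ≤ (max n k : ℕ) := by exact_mod_cast le_max_right n k
      exact hk.le.trans this

theorem directingMeasure_stormWindow_lt_top {μY : ℝ} (hμY : 0 < μY) (PX : Measure (PathSpace d))
    [IsFiniteMeasure PX] (ψ : PathSpace d) (n : ℕ) :
    directingMeasure μY PX ψ (stormWindow d n) < ∞ := by
  rw [stormWindow, directingMeasure_prod PX ψ Metric.isClosed_closedBall.measurableSet]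
  refine ENNReal.mul_lt_top (by simp [hμY]) (ENNReal.mul_lt_top
    (lintegral_path_lt_top ψ (isCompact_closedBall _ _)) (ENNReal.mul_lt_top ?_
      (measure_lt_top _ _)))
  refine (measure_union_le _ _).trans_lt ?_
  rw [severityMeasure_inv_le, severityMeasure_singleton_zero]
  simp

end Directing

/-! ### Contributing storms and their intensity -/

section Contributing

theorem measurable_contributingIntensity {α : Type*} [MeasurableSpace α] (μY : ℝ)
    (PX : Measure (PathSpace d)) [SFinite PX] {Q : Set (Space d)} (hQ : Q.Countable)
    {y : α → Space d → ℝ} (hy : ∀ t, Measurable fun a => y a t)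
    {ψ : α → PathSpace d} (hψ : Measurable ψ) (D : Set (Space d)) :
    Measurable fun a => ∫⁻ s in D, contributingIntensity μY PX Q (y a) (ψ a) s := by
  refine Measurable.lintegral_prod_right' (ν := volume.restrict D)
    (f := fun z : α × Space d => contributingIntensity μY PX Q (y z.1) (ψ z.1) z.2) ?_
  refine Measurable.mul (Measurable.const_mul ?_ _)
    (measurable_eval_path (hψ.comp measurable_fst) measurable_snd).ennreal_ofReal
  exact Measurable.lintegral_prod_right' (ν := PX)
    (f := fun z : (α × Space d) × PathSpace d => supRatio Q (y z.1.1) z.1.2 z.2)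
    (measurable_supRatio hQ (fun t => (hy t).comp measurable_fst.fst) measurable_fst.snd
      measurable_snd)

/-- On the compact `K` the threshold has a positive minimum, so the correcting factor is bounded;
the continuous `ψ` is integrable on the compact `K_R`. -/
theorem lintegral_contributingIntensity_lt_top {μY : ℝ} (hμY : 0 < μY) (PX : Measure (PathSpace d))
    [IsFiniteMeasure PX] {C R : ℝ} (hbdd : ∀ᵐ x ∂PX, ∀ t, x t ≤ C) {K : Set (Space d)}
    (hK : IsCompact K) {D : Set (Space d)} (hDK : D ⊆ K + Metric.closedBall (0 : Space d) R)
    {y : Space d → ℝ} (hy : ContinuousOn y K) (hpos : ∀ t ∈ K, 0 < y t) (ψ : PathSpace d) :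
    ∫⁻ s in D, contributingIntensity μY PX K y ψ s < ∞ := by
  rcases K.eq_empty_or_nonempty with rfl | hne
  · have : D = ∅ := by simpa using hDK
    simp [this]
  obtain ⟨t₀, ht₀, hmin⟩ := hK.exists_isMinOn hne hy
  have hcor : ∀ s, correctingFactor μY PX K y s
      ≤ (ENNReal.ofReal μY)⁻¹ * (ENNReal.ofReal C / ENNReal.ofReal (y t₀) * PX univ) := by
    intro s
    refine mul_le_mul_right ?_ _
    rw [← lintegral_const]
    refine lintegral_mono_ae ?_
    filter_upwards [hbdd] with x hx
    exact iSup₂_le fun t ht => ENNReal.div_le_div (ENNReal.ofReal_le_ofReal (hx _))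
      (ENNReal.ofReal_le_ofReal (hmin ht))
  have hfin : (ENNReal.ofReal μY)⁻¹ * (ENNReal.ofReal C / ENNReal.ofReal (y t₀) * PX univ) < ∞ :=
    ENNReal.mul_lt_top (by simp [hμY]) (ENNReal.mul_lt_top
      (ENNReal.div_lt_top ENNReal.ofReal_ne_top (by simpa using hpos t₀ ht₀)) (measure_lt_top _ _))
  calc ∫⁻ s in D, contributingIntensity μY PX K y ψ s
      ≤ ∫⁻ s in K + Metric.closedBall (0 : Space d) R, (ENNReal.ofReal μY)⁻¹ *
          (ENNReal.ofReal C / ENNReal.ofReal (y t₀) * PX univ) * ENNReal.ofReal (ψ s) := by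
        refine (lintegral_mono_set hDK).trans (lintegral_mono fun s => ?_)
        exact mul_le_mul_left (hcor s) _
    _ < ∞ := by
        rw [lintegral_const_mul' _ _ hfin.ne]
        exact ENNReal.mul_lt_top hfin
          (lintegral_path_lt_top ψ (hK.add (isCompact_closedBall _ _)))

variable {Ω : Type*}

instance (p : ℕ → Ω → Storm d) (K : Set (Space d)) (y : Space d → ℝ) (ω : Ω) :
    SFinite (contributing p K y ω) := by
  classical
  unfold contributing
  have (i : ℕ) : SFinite (if (p i ω).2.1⁻¹ ≤ supRatio K y (p i ω).1 (p i ω).2.2 then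
      Measure.dirac (p i ω).1 else 0) := by
    split_ifs <;> infer_instance
  infer_instance

theorem contributing_congr (p : ℕ → Ω → Storm d) {K Q : Set (Space d)} {y : Space d → ℝ}
    (h : supRatio K y = supRatio Q y) : contributing p K y = contributing p Q y := by
  unfold contributing
  rw [h]

theorem contributing_apply (p : ℕ → Ω → Storm d) {Q : Set (Space d)} (hQ : Q.Countable)
    (y : Space d → ℝ) (ω : Ω) {D : Set (Space d)} (hD : MeasurableSet D) :
    contributing p Q y ω D
      = pointProcess p ω {q | q.1 ∈ D ∧ q.2.1⁻¹ ≤ supRatio Q y q.1 q.2.2} := by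
  have hm := measurableSet_marked hD hQ y
  rw [contributing, pointProcess, Measure.sum_apply _ hD, Measure.sum_apply _ hm]
  congr 1
  ext i
  rw [Measure.dirac_apply' _ hm]
  by_cases h : (p i ω).2.1⁻¹ ≤ supRatio Q y (p i ω).1 (p i ω).2.2
  · rw [if_pos h, Measure.dirac_apply' _ hD]
    by_cases h' : (p i ω).1 ∈ D <;> simp [h, h']
  · rw [if_neg h]
    simp [h]

theorem contributingIntensity_congr (μY : ℝ) (PX : Measure (PathSpace d)) {K Q : Set (Space d)}
    {y : Space d → ℝ} (h : supRatio K y = supRatio Q y) (ψ : PathSpace d) :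
    contributingIntensity μY PX K y ψ = contributingIntensity μY PX Q y ψ := by
  unfold contributingIntensity correctingFactor
  rw [h]

end Contributing

/-! ### Almost sure existence of points -/

section Positivity

theorem exists_mem_of_pointProcess_ne_zero {Ω S : Type*} [MeasurableSpace S] {p : ℕ → Ω → S} {ω : Ω}
    {A : Set S} (hA : MeasurableSet A) (h : pointProcess p ω A ≠ 0) : ∃ i, p i ω ∈ A := by
  by_contra! hn
  refine h ?_
  rw [pointProcess, Measure.sum_apply _ hA]
  simp [Measure.dirac_apply' _ hA, hn]

variable {Ω : Type*} [MeasurableSpace Ω] {P : Measure Ω}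

/-- Positivity on a compact set is an open condition in the compact-open topology. -/
theorem measurableSet_pos_on_closedBall (r : ℝ) :
    MeasurableSet {x : PathSpace d | ∀ t ∈ Metric.closedBall (0 : Space d) r, 0 < x t} :=
  (ContinuousMap.isOpen_setOfPred_mapsTo (isCompact_closedBall _ _) isOpen_Ioi).measurableSet

/-- A Cox process almost surely has points in a set which is an increasing union of sets whose
directing measures are finite and tend to infinity. -/
theorem IsCoxProcess.ae_pointProcess_ne_zero {Z T S : Type*} [MeasurableSpace Z]
    [MeasurableSpace T] [MeasurableSpace S] [IsProbabilityMeasure P] {Ψ : Ω → Z} {W : Ω → T}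
    {p : ℕ → Ω → S} {κ : Kernel Z S} (hΨ : Measurable Ψ) (hW : Measurable W)
    (hp : ∀ i, Measurable (p i))
    (hN : IsCoxProcess (MeasurableSpace.comap Ψ inferInstance) (pointProcess p)
      (fun ω => κ (Ψ ω)) P)
    (hind : CondIndependent (MeasurableSpace.comap Ψ inferInstance)
      (MeasurableSpace.comap W inferInstance)
      (MeasurableSpace.comap (pointProcess p) inferInstance) P)
    {A : Set S} {B : ℕ → Set S} (hB : ∀ n, MeasurableSet (B n)) (hBA : ∀ n, B n ⊆ A)
    (hfin : ∀ n z, κ z (B n) < ∞)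
    (hlim : ∀ᵐ ω ∂P, Filter.Tendsto (fun n => (κ (Ψ ω) (B n)).toReal) Filter.atTop Filter.atTop) :
    ∀ᵐ ω ∂P, pointProcess p ω A ≠ 0 := by
  have hvoid : ∀ n, P {ω | pointProcess p ω (B n) = 0}
      = ∫⁻ ω, ENNReal.ofReal (Real.exp (-(κ (Ψ ω) (B n)).toReal)) ∂P := by
    intro n
    have h := hN.measure_inter_count hΨ hW hp hind (hB n) (hfin n) 0
      MeasurableSet.univ MeasurableSet.univ
    simpa [poissonMeasure_singleton, ENNReal.coe_toNNReal_eq_toReal] using h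
  -- The void probabilities of the `B n` tend to zero by dominated convergence, and each bounds that
  -- of `A`.
  have hto : Filter.Tendsto
      (fun n => ∫⁻ ω, ENNReal.ofReal (Real.exp (-(κ (Ψ ω) (B n)).toReal)) ∂P)
      Filter.atTop (nhds (∫⁻ _, 0 ∂P)) := by
    refine tendsto_lintegral_of_dominated_convergence (fun _ => 1) (fun n => ?_) (fun n => ?_)
      (by simp) ?_
    · have := (κ.measurable_coe (hB n)).comp hΨ
      exact (Real.measurable_exp.comp this.ennreal_toReal.neg).ennreal_ofReal
    · refine Filter.Eventually.of_forall fun ω => ENNReal.ofReal_le_one.2 ?_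
      exact Real.exp_le_one_iff.2 (neg_nonpos.2 ENNReal.toReal_nonneg)
    · filter_upwards [hlim] with ω hω
      have h := (Real.tendsto_exp_neg_atTop_nhds_zero.comp hω)
      simpa using ENNReal.tendsto_ofReal h
  rw [lintegral_zero] at hto
  refine le_antisymm (ge_of_tendsto' hto fun n => ?_) zero_le
  rw [← hvoid n]
  refine measure_mono fun ω hω => ?_
  simp only [mem_compl_iff, mem_ofPred_eq, not_not] at hω
  exact measure_mono_null (hBA n) hω

end Positivity

end CoxExtremal

/-! ### Positivity of the threshold and unbiasedness over events -/

namespace CoxExtremal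

variable {Ω : Type*} [MeasurableSpace Ω] {P : Measure Ω} {d : ℕ}

theorem condLExp_comap_ae_eq [IsProbabilityMeasure P] {β : Type*} [MeasurableSpace β] {V : Ω → β} (hV : Measurable V)
    {X Z : Ω → ℝ≥0∞} {g : β → ℝ≥0∞} (hg : Measurable g) (hZ : Z =ᵐ[P] fun ω => g (V ω))
    (h : ∀ E, MeasurableSet E → ∫⁻ ω in V ⁻¹' E, X ω ∂P = ∫⁻ ω in V ⁻¹' E, Z ω ∂P) :
    P⁻[X | MeasurableSpace.comap V inferInstance] =ᵐ[P] Z := by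
  refine Filter.EventuallyEq.symm (hZ.trans ?_)
  refine ae_eq_condLExp hV.comap_le P X (hg.comp (comap_measurable V)) ?_
  rintro _ ⟨E, hE, rfl⟩
  rw [h E hE]
  exact lintegral_congr_ae (ae_restrict_of_ae hZ.symm)

/-- The extremal process is almost surely bounded away from zero on small balls. -/
theorem ae_exists_le_extremalProcess [IsProbabilityMeasure P] {T : Type*}
    [MeasurableSpace T]
    {PX : Measure (PathSpace d)} [IsProbabilityMeasure PX] {r : ℝ} (hr : 0 < r)
    (hr_supp : 0 < PX {x | ∀ t ∈ Metric.closedBall (0 : Space d) r, 0 < x t})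
    {μY : ℝ} (hμY : 0 < μY) {Ψ : Ω → PathSpace d} (hΨ : Measurable Ψ)
    (hΨ_pos : ∀ᵐ ω ∂P, ∀ s, 0 < Ψ ω s) {p : ℕ → Ω → Storm d} (hp : ∀ i, Measurable (p i))
    (hN : IsCoxProcess (MeasurableSpace.comap Ψ inferInstance) (pointProcess p)
      (fun ω => directingMeasure μY PX (Ψ ω)) P) {W : Ω → T} (hW : Measurable W)
    (hindep : CondIndependent (MeasurableSpace.comap Ψ inferInstance)
      (MeasurableSpace.comap W inferInstance)
      (MeasurableSpace.comap (pointProcess p) inferInstance) P) (c : Space d) :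
    ∀ᵐ ω ∂P, ∃ n : ℕ, ∀ t ∈ Metric.closedBall c (r / 2), (n : ℝ≥0∞)⁻¹ ≤ extremalProcess p ω t := by
  set V : Set (PathSpace d) := {x | ∀ t ∈ Metric.closedBall (0 : Space d) r, 0 < x t} with hV
  have hVm : MeasurableSet V := measurableSet_pos_on_closedBall r
  set b := Metric.closedBall c (r / 2) with hb
  have hbm : MeasurableSet b := Metric.isClosed_closedBall.measurableSet
  simp_rw [← directingKernel_apply hμY] at hN
  -- The severity factor is exactly `n`, so the mass grows linearly and diverges wherever `Ψ` is
  -- positive.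
  have hmass : ∀ n (ψ : PathSpace d), directingKernel μY PX ψ (b ×ˢ {u : ℝ≥0∞ | u⁻¹ ≤ (n : ℕ)} ×ˢ V)
      = n * ((ENNReal.ofReal μY)⁻¹ * ((∫⁻ s in b, ENNReal.ofReal (ψ s)) * PX V)) := by
    intro n ψ
    rw [directingKernel_apply hμY, directingMeasure_prod PX ψ hbm, severityMeasure_inv_le]
    ring
  have hfin : ∀ ψ : PathSpace d,
      (ENNReal.ofReal μY)⁻¹ * ((∫⁻ s in b, ENNReal.ofReal (ψ s)) * PX V) < ∞ := fun ψ =>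
    ENNReal.mul_lt_top (by simp [hμY]) (ENNReal.mul_lt_top
      (lintegral_path_lt_top ψ (isCompact_closedBall _ _)) (measure_lt_top _ _))
  have hne : ∀ᵐ ω ∂P, pointProcess p ω (b ×ˢ {u : ℝ≥0∞ | u ≠ 0} ×ˢ V) ≠ 0 := by
    refine hN.ae_pointProcess_ne_zero hΨ hW hp hindep
      (B := fun n : ℕ => b ×ˢ {u : ℝ≥0∞ | u⁻¹ ≤ (n : ℕ)} ×ˢ V)
      (fun n => hbm.prod ((measurableSet_inv_le _).prod hVm)) (fun n => ?_) (fun n z => ?_) ?_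
    · refine prod_mono_right (prod_mono_left fun u hu h0 => ?_)
      simp [h0] at hu
    · rw [hmass]
      exact ENNReal.mul_lt_top (ENNReal.natCast_lt_top n) (hfin z)
    · filter_upwards [hΨ_pos] with ω hω
      simp_rw [hmass, ENNReal.toReal_mul, ENNReal.toReal_natCast]
      refine Filter.Tendsto.atTop_mul_const ?_ tendsto_natCast_atTop_atTop
      rw [← ENNReal.toReal_mul, ← ENNReal.toReal_mul]
      refine ENNReal.toReal_pos (mul_ne_zero (by simp) (mul_ne_zero ?_ hr_supp.ne')) (hfin _).ne
      refine ((setLIntegral_pos_iff (Ψ ω).continuous.measurable.ennreal_ofReal).2 ?_).ne'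
      have hs : Function.support (fun s => ENNReal.ofReal (Ψ ω s)) = univ :=
        eq_univ_of_forall fun s => by simpa using hω s
      rw [hs, univ_inter]
      exact Metric.measure_closedBall_pos volume _ (half_pos hr)
  filter_upwards [hne] with ω hω
  obtain ⟨i, hi₁, hi₂, hi₃⟩ := exists_mem_of_pointProcess_ne_zero
    (hbm.prod ((measurableSet_singleton 0).compl.prod hVm)) hω
  obtain ⟨t₀, ht₀, hmin⟩ := (isCompact_closedBall (0 : Space d) r).exists_isMinOn
    (Metric.nonempty_closedBall.2 hr.le) (p i ω).2.2.continuous.continuousOn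
  have hpos : (p i ω).2.1 * ENNReal.ofReal ((p i ω).2.2 t₀) ≠ 0 :=
    mul_ne_zero hi₂ (by simpa using hi₃ t₀ ht₀)
  obtain ⟨n, hn⟩ := ENNReal.exists_inv_nat_lt hpos
  refine ⟨n, fun t ht => hn.le.trans (le_iSup_of_le i (mul_le_mul_right ?_ _))⟩
  refine ENNReal.ofReal_le_ofReal (hmin ?_)
  -- Centre and `t` both lie within `r / 2` of `c`, so `t - s_i` stays in the ball of radius `r`
  -- where the shape is bounded below by its positive minimum.
  rw [mem_closedBall_zero_iff, ← dist_eq_norm]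
  calc dist t (p i ω).1 ≤ dist t c + dist (p i ω).1 c := dist_triangle_right _ _ _
    _ ≤ r / 2 + r / 2 := add_le_add ht hi₁
    _ = r := add_halves r

theorem exists_countable_dense (s : Set (Space d)) :
    ∃ t ⊆ s, t.Countable ∧ s ⊆ closure t :=
  (TopologicalSpace.IsSeparable.of_separableSpace s).exists_countable_dense_subset

/-- A continuous copy of a process which is bounded away from zero on small balls is positive. -/
theorem ae_forall_pos_of_identDistrib {Y : Ω → Space d → ℝ≥0∞} {Ystar : Ω → PathSpace d}
    (hcopy : IdentDistrib (fun ω t => ENNReal.ofReal (Ystar ω t)) Y P P) {ρ : ℝ} (hρ : 0 < ρ)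
    (hY : ∀ c, ∀ᵐ ω ∂P, ∃ n : ℕ, ∀ t ∈ Metric.closedBall c ρ, (n : ℝ≥0∞)⁻¹ ≤ Y ω t) :
    ∀ᵐ ω ∂P, ∀ t, 0 < Ystar ω t := by
  have hball : ∀ c, ∀ᵐ ω ∂P, ∀ t ∈ Metric.closedBall c ρ, 0 < Ystar ω t := by
    intro c
    -- Equality in law lives on the product `σ`-algebra, so the bound is transferred on countably
    -- many coordinates and recovered on the ball by continuity of `Ystar`.
    obtain ⟨Q, hQ, hQc, hQd⟩ := exists_countable_dense (Metric.closedBall c ρ)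
    have hm : MeasurableSet {f : Space d → ℝ≥0∞ | ∃ n : ℕ, ∀ t ∈ Q, (n : ℝ≥0∞)⁻¹ ≤ f t} := by
      have : {f : Space d → ℝ≥0∞ | ∃ n : ℕ, ∀ t ∈ Q, (n : ℝ≥0∞)⁻¹ ≤ f t}
          = ⋃ n : ℕ, ⋂ t ∈ Q, {f | (n : ℝ≥0∞)⁻¹ ≤ f t} := by
        ext f
        simp
      rw [this]
      exact MeasurableSet.iUnion fun n => MeasurableSet.biInter hQc fun t _ =>
        measurableSet_le measurable_const (measurable_pi_apply t)
    have h := hcopy.symm.ae_snd hm ((hY c).mono fun ω ⟨n, hn⟩ => ⟨n, fun t ht => hn t (hQ ht)⟩)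
    filter_upwards [h] with ω ⟨n, hn⟩ t ht
    have hcl : IsClosed {t | (n : ℝ≥0∞)⁻¹ ≤ ENNReal.ofReal (Ystar ω t)} :=
      isClosed_le continuous_const (ENNReal.continuous_ofReal.comp (Ystar ω).continuous)
    have hle : (n : ℝ≥0∞)⁻¹ ≤ ENNReal.ofReal (Ystar ω t) :=
      closure_minimal (fun t ht => hn t ht) hcl (hQd ht)
    exact ENNReal.ofReal_pos.1 ((ENNReal.inv_pos.2 (ENNReal.natCast_ne_top n)).trans_le hle)
  have hall : ∀ᵐ ω ∂P, ∀ k, ∀ t ∈ Metric.closedBall (TopologicalSpace.denseSeq (Space d) k) ρ,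
      0 < Ystar ω t := ae_all_iff.2 fun k => hball _
  filter_upwards [hall] with ω hω t
  obtain ⟨k, hk⟩ := (TopologicalSpace.denseRange_denseSeq (Space d)).exists_dist_lt t hρ
  exact hω k t (Metric.mem_closedBall.2 hk.le)

/-- Unbiasedness of the total mass of the kernel estimator on events determined by the spatial
intensity and by a variable that is conditionally independent of the storms, which may enter the
threshold. -/
theorem setLIntegral_kernelEstimator [IsProbabilityMeasure P] {T : Type*}
    [MeasurableSpace T]
    {PX : Measure (PathSpace d)} [IsProbabilityMeasure PX] {μY : ℝ} (hμY : 0 < μY)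
    {Ψ : Ω → PathSpace d} (hΨ : Measurable Ψ) {p : ℕ → Ω → Storm d} (hp : ∀ i, Measurable (p i))
    (hN : IsCoxProcess (MeasurableSpace.comap Ψ inferInstance) (pointProcess p)
      (fun ω => directingMeasure μY PX (Ψ ω)) P) {W : Ω → T} (hW : Measurable W)
    (hindep : CondIndependent (MeasurableSpace.comap Ψ inferInstance)
      (MeasurableSpace.comap W inferInstance)
      (MeasurableSpace.comap (pointProcess p) inferInstance) P)
    {Q : Set (Space d)} (hQ : Q.Countable) {y : T → Space d → ℝ}
    (hy : ∀ t, Measurable fun w => y w t) {D : Set (Space d)} (hD : MeasurableSet D)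
    (hDfin : volume D < ∞) {h : ℝ} (hh : 0 < h) {E : Set (PathSpace d × T)}
    (hE : MeasurableSet E) :
    ∫⁻ ω in (fun ω => (Ψ ω, W ω)) ⁻¹' E,
        (∫⁻ s in D, kernelEstimator h D (contributing p Q (y (W ω)) ω) s) ∂P
      = ∫⁻ ω in (fun ω => (Ψ ω, W ω)) ⁻¹' E,
        (∫⁻ s in D, contributingIntensity μY PX Q (y (W ω)) (Ψ ω) s) ∂P := by
  set D' : Set (Space d) := {t | edgeWeight h D t ≠ 0} ∩ D with hD'
  have hD'm : MeasurableSet D' :=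
    (measurable_edgeWeight h D (measurableSet_singleton 0)).compl.inter hD
  have hDD' : D' =ᵐ[volume] D := by
    refine (LE.le.eventuallyLE inter_subset_right).antisymm ?_
    rw [ae_le_set]
    refine measure_mono_null (fun t ht => ?_) (volume_edgeWeight_eq_zero hh hD)
    exact ⟨not_not.1 fun h0 => ht.2 ⟨h0, ht.1⟩, ht.1⟩
  -- The conditioning event `E` is built into the random set, so that Campbell's formula yields the
  -- integral over the event.
  set G : Set (PathSpace d × T × Storm d) := {z | (z.1, z.2.1) ∈ E ∧ z.2.2.1 ∈ D' ∧
    z.2.2.2.1⁻¹ ≤ supRatio Q (y z.2.1) z.2.2.1 z.2.2.2.2} with hG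
  have hGm : MeasurableSet G := by
    have h₁ : Measurable fun z : PathSpace d × T × Storm d =>
        supRatio Q (y z.2.1) z.2.2.1 z.2.2.2.2 :=
      measurable_supRatio hQ (fun t => (hy t).comp measurable_snd.fst) measurable_snd.snd.fst
        measurable_snd.snd.snd.snd
    have h₂ : Measurable fun z : PathSpace d × T × Storm d => z.2.2.2.1⁻¹ :=
      measurable_snd.snd.snd.fst.inv
    have h₃ : Measurable fun z : PathSpace d × T × Storm d => (z.1, z.2.1) :=
      measurable_fst.prodMk measurable_snd.fst
    have h₄ : Measurable fun z : PathSpace d × T × Storm d => z.2.2.1 := measurable_snd.snd.fst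
    exact (h₃ hE).inter ((h₄ hD'm).inter (measurableSet_le h₂ h₁))
  have hpre : MeasurableSet ((fun ω => (Ψ ω, W ω)) ⁻¹' E) := (hΨ.prodMk hW) hE
  have hsec : ∀ (ν : Measure (Storm d)) ω, ν {q | (Ψ ω, W ω, q) ∈ G}
      = ((fun ω => (Ψ ω, W ω)) ⁻¹' E).indicator
        (fun ω => ν {q | q.1 ∈ D' ∧ q.2.1⁻¹ ≤ supRatio Q (y (W ω)) q.1 q.2.2}) ω := by
    intro ν ω
    by_cases hω : ω ∈ (fun ω => (Ψ ω, W ω)) ⁻¹' E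
    · rw [indicator_of_mem hω]
      congr 1
      ext q
      exact and_iff_right hω
    · have h0 : {q | (Ψ ω, W ω, q) ∈ G} = ∅ := eq_empty_of_forall_notMem fun q hq => hω hq.1
      rw [indicator_of_notMem hω, h0, measure_empty]
  simp_rw [← directingKernel_apply hμY] at hN
  have key := hN.lintegral_randomSet hΨ hW hp hindep measurableSet_stormWindow
    (fun n z => by
      rw [directingKernel_apply hμY]
      exact directingMeasure_stormWindow_lt_top hμY PX z n) iUnion_stormWindow hGm
  rw [← lintegral_indicator hpre, ← lintegral_indicator hpre]
  refine Eq.trans (lintegral_congr fun ω => ?_) (key.trans (lintegral_congr fun ω => ?_))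
  · rw [hsec]
    by_cases hω : ω ∈ (fun ω => (Ψ ω, W ω)) ⁻¹' E
    · rw [indicator_of_mem hω, indicator_of_mem hω, lintegral_kernelEstimator hh hDfin,
        contributing_apply p hQ _ ω hD'm]
    · rw [indicator_of_notMem hω, indicator_of_notMem hω]
  · rw [hsec]
    by_cases hω : ω ∈ (fun ω => (Ψ ω, W ω)) ⁻¹' E
    · rw [indicator_of_mem hω, indicator_of_mem hω, directingKernel_apply hμY,
        directingMeasure_marked hμY PX _ hD'm hQ, setLIntegral_congr hDD']
    · rw [indicator_of_notMem hω, indicator_of_notMem hω]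

end CoxExtremal

/-! ### Assembly of the theorem -/

open CoxExtremal in
theorem mainTheorem9
    {Ω : Type*} [MeasurableSpace Ω] (P : Measure Ω) [IsProbabilityMeasure P] (d : ℕ)
    -- the law of the storm process, its conditions, and the scaling constant
    (PX : Measure (PathSpace d)) [IsProbabilityMeasure PX]
    (C R : ℝ) (hC : 0 < C) (hR : 0 < R)
    (hX_nonneg : ∀ᵐ x ∂PX, ∀ t, 0 ≤ x t)
    (hX_bounded : ∀ᵐ x ∂PX, ∀ t,
      x t ≤ (Metric.closedBall (0 : Space d) R).indicator (fun _ => C) t)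
    (hX_supp : ∃ r : ℝ, 0 < r ∧ 0 < PX {x | ∀ t ∈ Metric.closedBall (0 : Space d) r, 0 < x t})
    (μY : ℝ) (hμY : 0 < μY)
    -- the spatial intensity process
    (Ψ : Ω → PathSpace d) (hΨ : Measurable Ψ) (hΨ_pos : ∀ᵐ ω ∂P, ∀ s, 0 < Ψ ω s)
    -- the Cox process of storms `(s_i, u_i, X_i)`
    (p : ℕ → Ω → Storm d) (hp : ∀ i, Measurable (p i))
    (hN : IsCoxProcess (MeasurableSpace.comap Ψ inferInstance) (pointProcess p)
      (fun ω => directingMeasure μY PX (Ψ ω)) P)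
    -- conditionally on `Ψ`, the process `Ystar` is a copy of the Cox extremal process
    -- which is independent of the Cox process of storms
    (Ystar : Ω → PathSpace d) (hYstar : Measurable Ystar)
    (hcopy : IdentDistrib (fun ω => (Ψ ω, fun t => ENNReal.ofReal (Ystar ω t)))
      (fun ω => (Ψ ω, extremalProcess p ω)) P P)
    (hindep : CondIndependent (MeasurableSpace.comap Ψ inferInstance)
      (MeasurableSpace.comap Ystar inferInstance)
      (MeasurableSpace.comap (pointProcess p) inferInstance) P)
    -- the compact set `K`, the domain `D ⊆ K_R`, and the bandwidth `h`
    (K : Set (Space d)) (hK : IsCompact K)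
    (D : Set (Space d)) (hD : MeasurableSet D) (hDK : D ⊆ K + Metric.closedBall (0 : Space d) R)
    (h : ℝ) (hh : 0 < h) :
    -- a fixed threshold `y`, conditionally on `Ψ` and in mean
    (∀ y : Space d → ℝ, ContinuousOn y K → (∀ t ∈ K, 0 < y t) →
      (∀ᵐ ω ∂P, (∫⁻ s in D, contributingIntensity μY PX K y (Ψ ω) s) < ∞) ∧
      P⁻[fun ω => ∫⁻ s in D, kernelEstimator h D (contributing p K y ω) s |
          MeasurableSpace.comap Ψ inferInstance]
        =ᵐ[P] (fun ω => ∫⁻ s in D, contributingIntensity μY PX K y (Ψ ω) s) ∧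
      ∫⁻ ω, (∫⁻ s in D, kernelEstimator h D (contributing p K y ω) s) ∂P
        = ∫⁻ ω, (∫⁻ s in D, contributingIntensity μY PX K y (Ψ ω) s) ∂P) ∧
    -- the threshold `Ystar`, conditionally on `(Ψ, Ystar)`, conditionally on `Ystar`, and in mean
    (∀ᵐ ω ∂P, (∫⁻ s in D, contributingIntensity μY PX K (Ystar ω) (Ψ ω) s) < ∞) ∧
    P⁻[fun ω => ∫⁻ s in D, kernelEstimator h D (contributing p K (Ystar ω) ω) s |
        MeasurableSpace.comap (fun ω => (Ψ ω, Ystar ω)) inferInstance]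
      =ᵐ[P] (fun ω => ∫⁻ s in D, contributingIntensity μY PX K (Ystar ω) (Ψ ω) s) ∧
    P⁻[fun ω => ∫⁻ s in D, kernelEstimator h D (contributing p K (Ystar ω) ω) s |
        MeasurableSpace.comap Ystar inferInstance]
      =ᵐ[P] P⁻[fun ω => ∫⁻ s in D, contributingIntensity μY PX K (Ystar ω) (Ψ ω) s |
        MeasurableSpace.comap Ystar inferInstance] ∧
    ∫⁻ ω, (∫⁻ s in D, kernelEstimator h D (contributing p K (Ystar ω) ω) s) ∂P
      = ∫⁻ ω, (∫⁻ s in D, contributingIntensity μY PX K (Ystar ω) (Ψ ω) s) ∂P := by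
  obtain ⟨r, hr, hr_supp⟩ := hX_supp
  have hbdd : ∀ᵐ x ∂PX, ∀ t, x t ≤ C := hX_bounded.mono fun x hx t =>
    (hx t).trans (indicator_apply_le' (fun _ => le_rfl) fun _ => hC.le)
  have hDfin : volume D < ∞ := (measure_mono hDK).trans_lt
    (hK.add (isCompact_closedBall _ _)).measure_lt_top
  obtain ⟨Q, hQK, hQ, hKQ⟩ := exists_countable_dense K
  have hpos : ∀ᵐ ω ∂P, ∀ t, 0 < Ystar ω t :=
    ae_forall_pos_of_identDistrib (hcopy.comp measurable_snd) (half_pos hr)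
      (ae_exists_le_extremalProcess hr hr_supp hμY hΨ hΨ_pos hp hN hYstar hindep)
  have hint := fun {y : PathSpace d → Space d → ℝ} (hy : ∀ t, Measurable fun w => y w t)
    {E : Set (PathSpace d × PathSpace d)} (hE : MeasurableSet E) =>
    setLIntegral_kernelEstimator hμY hΨ hp hN hYstar hindep hQ hy hD hDfin hh hE
  refine ⟨fun y hy hy_pos => ?_, ?_⟩
  · have hsup := supRatio_eq_of_dense hQK hKQ hy hy_pos
    refine ⟨Filter.Eventually.of_forall fun ω =>
      lintegral_contributingIntensity_lt_top hμY PX hbdd hK hDK hy hy_pos (Ψ ω), ?_⟩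
    simp_rw [contributing_congr p hsup, contributingIntensity_congr μY PX hsup]
    have hconst : ∀ t, Measurable fun _ : PathSpace d => y t := fun _ => measurable_const
    constructor
    · refine condLExp_comap_ae_eq hΨ (measurable_contributingIntensity μY PX hQ
        (y := fun _ => y) hconst measurable_id D) (Filter.EventuallyEq.refl _ _) fun E hE => ?_
      -- An event of `Ψ` alone is a cylinder in the pair `(Ψ, Ystar)`.
      exact hint (y := fun _ => y) hconst (measurable_fst hE)
    · simpa using hint (y := fun _ => y) hconst MeasurableSet.univ
  · have heval : ∀ t, Measurable fun w : PathSpace d => w t := fun t =>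
      measurable_eval_path measurable_id measurable_const
    have hsup : ∀ᵐ ω ∂P, supRatio K (Ystar ω) = supRatio Q (Ystar ω) := hpos.mono fun ω hω =>
      supRatio_eq_of_dense hQK hKQ (Ystar ω).continuous.continuousOn fun t _ => hω t
    have hX : (fun ω => ∫⁻ s in D, kernelEstimator h D (contributing p K (Ystar ω) ω) s) =ᵐ[P]
        fun ω => ∫⁻ s in D, kernelEstimator h D (contributing p Q (Ystar ω) ω) s :=
      hsup.mono fun ω hω => by simp only [contributing_congr p hω]
    have hZ : (fun ω => ∫⁻ s in D, contributingIntensity μY PX K (Ystar ω) (Ψ ω) s) =ᵐ[P]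
        fun ω => ∫⁻ s in D, contributingIntensity μY PX Q (Ystar ω) (Ψ ω) s :=
      hsup.mono fun ω hω => by simp only [contributingIntensity_congr μY PX hω]
    have hset : ∀ E, MeasurableSet E → ∫⁻ ω in (fun ω => (Ψ ω, Ystar ω)) ⁻¹' E,
          (∫⁻ s in D, kernelEstimator h D (contributing p K (Ystar ω) ω) s) ∂P
        = ∫⁻ ω in (fun ω => (Ψ ω, Ystar ω)) ⁻¹' E,
          (∫⁻ s in D, contributingIntensity μY PX K (Ystar ω) (Ψ ω) s) ∂P := by
      intro E hE
      rw [lintegral_congr_ae (ae_restrict_of_ae hX), lintegral_congr_ae (ae_restrict_of_ae hZ)]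
      exact hint (y := fun w => w) heval hE
    refine ⟨hpos.mono fun ω hω => lintegral_contributingIntensity_lt_top hμY PX hbdd hK hDK
      (Ystar ω).continuous.continuousOn (fun t _ => hω t) (Ψ ω), ?_, ?_, ?_⟩
    · exact condLExp_comap_ae_eq (hΨ.prodMk hYstar) (measurable_contributingIntensity μY PX hQ
        (y := fun z : PathSpace d × PathSpace d => z.2) (fun t => (heval t).comp measurable_snd)
        measurable_fst D) hZ hset
    -- The intensity integral also depends on `Ψ`, so both conditional expectations are compared
    -- through their integrals over events of `Ystar`, again cylinders of the pair.
    · refine (ae_eq_condLExp hYstar.comap_le P _ (measurable_condLExp _ _ _) ?_).symm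
      rintro _ ⟨E, hE, rfl⟩
      rw [setLIntegral_condLExp hYstar.comap_le P _ ⟨E, hE, rfl⟩]
      exact (hset _ (measurable_snd hE)).symm
    · simpa using hset univ MeasurableSet.univ
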